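/- Let $\alpha\in(0,1)$ and $\beta\in\mathbb{R}$. Let $\lambda:[0,\infty)\to(0,\infty)$ be locally integrable, put $\Lambda(t)=\int_0^t\lambda(\tau)\,d\tau$, and assume that $\Lambda(t)\to\infty$ as $t\to\infty$. Let $(N_1(t))_{t\ge 0}$ be a standard Poisson process with intensity $1$, and let $N(t)=N_1(\Lambda(t))$ be the associated non-homogeneous Poisson process. Let $(L_\alpha(t))_{t\ge 0}$ be the $\alpha$-stable subordinator, that is, the nondecreasing Lévy process with $\mathbb{E}[e^{-uL_\alpha(t)}]=e^{-tu^\alpha}$ for all $t,u\ge 0$, and let $Y_\alpha(t)=\inf\{u\ge 0: L_\alpha(u)>t\}$, $t\ge 0$, be its inverse. Assume that the processes $(Y_\alpha(t))_{t\ge 0}$ and $(N(t))_{t\ge 0}$ are defined on the same probability space and are independent, and define the fractional non-homogeneous Poisson process by $N_\alpha(t)=N(Y_\alpha(t))=N_1(\Lambda(Y_\alpha(t)))$. Suppose that $\Lambda$ is regularly varying with index $\beta$, that is, $\Lambda(xt)/\Lambda(t)\to x^\beta$ as $t\to\infty$ for every $x>0$. Then $$\frac{N_\alpha(t)}{\Lambda(t^\alpha)}\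 \xrightarrow[t\to\infty]{d}\ (Y_\alpha(1))^\beta ,$$ where $\xrightarrow{d}$ denotes convergence in distribution. -/

import Mathlib

open MeasureTheory ProbabilityTheory Filter Topology
open scoped NNReal

noncomputable section

/-- A function on `[0, ∞)` is càdlàg: right-continuous with (finite) left limits. At `0` the
left-limit condition is void because `𝓝[<] 0 = ⊥`. -/
def IsCadlag (f : ℝ≥0 → ℝ) : Prop :=
  ∀ t, ContinuousWithinAt f (Set.Ici t) t ∧ ∃ l, Tendsto f (𝓝[<] t) (𝓝 l)

/-- Real-valued Lévy processes: started at `0`, with independent and stationary increments and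
almost surely càdlàg paths. -/
structure IsLevyProcess {Ω : Type*} [MeasurableSpace Ω] (X : ℝ≥0 → Ω → ℝ) (P : Measure Ω) :
    Prop where
  measurable : ∀ t, Measurable (X t)
  zero : ∀ᵐ ω ∂P, X 0 ω = 0
  indepIncrements : HasIndepIncrements X P
  stationaryIncrements :
    ∀ s t, IdentDistrib (fun ω => X (s + t) ω - X s ω) (X t) P P
  cadlag : ∀ᵐ ω ∂P, IsCadlag (fun t => X t ω)

/-- Standard Poisson process (with intensity `1`): an `ℕ`-valued Lévy process whose value at time
`t` is Poisson distributed with parameter `t`. -/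
structure IsStandardPoissonProcess {Ω : Type*} [MeasurableSpace Ω] (N : ℝ≥0 → Ω → ℕ)
    (P : Measure Ω) : Prop where
  levy : IsLevyProcess (fun t ω => (N t ω : ℝ)) P
  law : ∀ t, HasLaw (N t) (poissonMeasure t) P

/-- The `α`-stable subordinator: a Lévy process with almost surely nondecreasing paths and
Laplace transform `𝔼[exp (-u L(t))] = exp (-t u ^ α)`, `u ≥ 0`. -/
structure IsStableSubordinator {Ω : Type*} [MeasurableSpace Ω] (α : ℝ) (L : ℝ≥0 → Ω → ℝ)
    (P : Measure Ω) : Prop where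
  levy : IsLevyProcess L P
  monotone : ∀ᵐ ω ∂P, Monotone (fun t => L t ω)
  laplace : ∀ (t : ℝ≥0) (u : ℝ), 0 ≤ u →
    ∫ ω, Real.exp (-u * L t ω) ∂P = Real.exp (-(t : ℝ) * u ^ α)

/-- The inverse (first passage) process `Y(t) = inf {u ≥ 0 : L(u) > t}`. -/
def inverseProcess {Ω : Type*} (L : ℝ≥0 → Ω → ℝ) (t : ℝ≥0) (ω : Ω) : ℝ≥0 :=
  sInf {u : ℝ≥0 | (t : ℝ) < L u ω}

/-- The cumulative rate function `Λ(t) = ∫₀ᵗ λ(τ) dτ`. -/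
def cumulativeRate (rate : ℝ → ℝ) (t : ℝ) : ℝ :=
  ∫ τ in (0 : ℝ)..t, rate τ

/-- The non-homogeneous Poisson process `N(t) = N₁(Λ(t))`. For a nonnegative rate, `Λ(t) ≥ 0` and
`Real.toNNReal` only changes the type. -/
def nonhomogeneousPoisson {Ω : Type*} (N₁ : ℝ≥0 → Ω → ℕ) (rate : ℝ → ℝ) (t : ℝ≥0) (ω : Ω) : ℕ :=
  N₁ (cumulativeRate rate t).toNNReal ω

/-- The fractional non-homogeneous Poisson process `N_α(t) = N(Y(t)) = N₁(Λ(Y(t)))`, where `Y` is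
the inverse of `L`. -/
def fractionalPoisson {Ω : Type*} (N₁ : ℝ≥0 → Ω → ℕ) (rate : ℝ → ℝ) (L : ℝ≥0 → Ω → ℝ)
    (t : ℝ≥0) (ω : Ω) : ℕ :=
  nonhomogeneousPoisson N₁ rate (inverseProcess L t ω) ω

/-- Regular variation at infinity with index `β`. -/
def IsRegularlyVarying (f : ℝ → ℝ) (β : ℝ) : Prop :=
  ∀ x : ℝ, 0 < x → Tendsto (fun t => f (x * t) / f t) atTop (𝓝 (x ^ β))

end

/-!
Characteristic functions reduce the limit theorem to a pointwise limit. Put `c = Λ(t ^ α)`.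
Conditioning on the independent random time `Y(t)` (`integral_comp_randomTime`) and the formula for
the Poisson characteristic function give
`𝔼[exp (i u N_α(t) / c)] = 𝔼[exp (Λ(Y(t)) * (exp (i u / c) - 1))]`.
The right side depends on the law of `Y(t)` only, and `Y(t)` has the law of `t ^ α * Y(1)`
(`IsStableSubordinator.identDistrib_inverseProcess`). Since `Y(1) > 0` almost surely, regular
variation yields `Λ(t ^ α * Y(1)) / Λ(t ^ α) → Y(1) ^ β`, while `c * (exp (i u / c) - 1) → i u`.
The integrand is bounded by `1`, so dominated convergence gives the limit `𝔼[exp (i u Y(1) ^ β)]`,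
and Lévy's continuity theorem concludes.

The self-similarity of `Y` comes from that of `L`, for which the Laplace transform has to determine
the law. This is the Hausdorff moment problem for `exp (-L(u))`, solved by Weierstrass
approximation (`identDistrib_of_laplace_eq`). Since `Y(t) < b` implies `L(b) > t`, which implies
`Y(t) ≤ b`, the laws of `L` control those of `Y`.
-/

/-! ### Laws determined by moments, Laplace transforms and distribution functions -/

/-- Uniqueness in the Hausdorff moment problem: by Weierstrass approximation, probability measures
carried by `[0, 1]` are determined by their moments. -/
theorem measure_eq_of_moments_eq_of_Icc {μ ν : Measure ℝ} [IsProbabilityMeasure μ]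
    [IsProbabilityMeasure ν] (hμ : ∀ᵐ x ∂μ, x ∈ Set.Icc (0 : ℝ) 1)
    (hν : ∀ᵐ x ∂ν, x ∈ Set.Icc (0 : ℝ) 1) (h : ∀ n : ℕ, ∫ x, x ^ n ∂μ = ∫ x, x ^ n ∂ν) :
    μ = ν := by
  have hpow : ∀ (ρ : Measure ℝ) [IsProbabilityMeasure ρ], (∀ᵐ x ∂ρ, x ∈ Set.Icc (0 : ℝ) 1) →
      ∀ n : ℕ, Integrable (fun x => x ^ n) ρ := by
    intro ρ _ hρ n
    refine Integrable.of_bound (by fun_prop) 1 ?_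
    filter_upwards [hρ] with x hx
    rw [Real.norm_of_nonneg (pow_nonneg hx.1 n)]
    exact pow_le_one₀ hx.1 hx.2
  have hpoly : ∀ (ρ : Measure ℝ) [IsProbabilityMeasure ρ], (∀ᵐ x ∂ρ, x ∈ Set.Icc (0 : ℝ) 1) →
      ∀ p : Polynomial ℝ, Integrable (fun x => p.eval x) ρ := by
    intro ρ _ hρ p
    simp_rw [Polynomial.eval_eq_sum_range]
    exact integrable_finsetSum _ fun i _ => (hpow ρ hρ i).const_mul _
  have hpolyeq : ∀ p : Polynomial ℝ, ∫ x, p.eval x ∂μ = ∫ x, p.eval x ∂ν := by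
    intro p
    simp_rw [Polynomial.eval_eq_sum_range]
    rw [integral_finsetSum _ fun i _ => (hpow μ hμ i).const_mul _,
      integral_finsetSum _ fun i _ => (hpow ν hν i).const_mul _]
    simp_rw [integral_const_mul, h]
  refine ext_of_forall_integral_eq_of_IsFiniteMeasure fun f => ?_
  refine eq_of_forall_dist_le fun ε hε => ?_
  obtain ⟨p, hp⟩ := exists_polynomial_near_of_continuousOn 0 1 f f.continuous.continuousOn (ε / 2)
    (half_pos hε)
  have key : ∀ (ρ : Measure ℝ) [IsProbabilityMeasure ρ], (∀ᵐ x ∂ρ, x ∈ Set.Icc (0 : ℝ) 1) →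
      dist (∫ x, f x ∂ρ) (∫ x, p.eval x ∂ρ) ≤ ε / 2 := by
    intro ρ _ hρ
    rw [dist_eq_norm, ← integral_sub (f.integrable ρ) (hpoly ρ hρ p)]
    refine (norm_integral_le_of_norm_le_const (C := ε / 2) ?_).trans (by simp)
    filter_upwards [hρ] with x hx
    rw [Real.norm_eq_abs, abs_sub_comm]
    exact (hp x hx).le
  calc dist (∫ x, f x ∂μ) (∫ x, f x ∂ν)
      ≤ dist (∫ x, f x ∂μ) (∫ x, p.eval x ∂μ) + dist (∫ x, f x ∂ν) (∫ x, p.eval x ∂μ) :=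
        dist_triangle_right _ _ _
    _ ≤ ε / 2 + ε / 2 := add_le_add (key μ hμ) (by rw [hpolyeq]; exact key ν hν)
    _ = ε := add_halves ε

/-- Uniqueness of Laplace transforms: the law of an almost surely nonnegative random variable is
determined by its Laplace transform at the natural numbers, because these values are the moments
of `exp (-X) ∈ [0, 1]`. -/
theorem identDistrib_of_laplace_eq {Ω : Type*} [MeasurableSpace Ω] {P : Measure Ω}
    [IsProbabilityMeasure P] {X Y : Ω → ℝ} (hX : AEMeasurable X P) (hY : AEMeasurable Y P)
    (hX0 : ∀ᵐ ω ∂P, 0 ≤ X ω) (hY0 : ∀ᵐ ω ∂P, 0 ≤ Y ω)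
    (h : ∀ n : ℕ, ∫ ω, Real.exp (-n * X ω) ∂P = ∫ ω, Real.exp (-n * Y ω) ∂P) :
    IdentDistrib X Y P P := by
  have hexp : IdentDistrib (fun ω => Real.exp (-X ω)) (fun ω => Real.exp (-Y ω)) P P := by
    have hXm : AEMeasurable (fun ω => Real.exp (-X ω)) P := by fun_prop
    have hYm : AEMeasurable (fun ω => Real.exp (-Y ω)) P := by fun_prop
    refine ⟨hXm, hYm, ?_⟩
    have := Measure.isProbabilityMeasure_map hXm
    have := Measure.isProbabilityMeasure_map hYm
    refine measure_eq_of_moments_eq_of_Icc ?_ ?_ fun n => ?_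
    · refine (ae_map_iff hXm measurableSet_Icc).2 ?_
      filter_upwards [hX0] with ω hω
      exact ⟨(Real.exp_pos _).le, Real.exp_le_one_iff.2 (by linarith)⟩
    · refine (ae_map_iff hYm measurableSet_Icc).2 ?_
      filter_upwards [hY0] with ω hω
      exact ⟨(Real.exp_pos _).le, Real.exp_le_one_iff.2 (by linarith)⟩
    · rw [integral_map hXm (by fun_prop), integral_map hYm (by fun_prop)]
      simpa [← Real.exp_nat_mul] using h n
  simpa [Function.comp_def] using
    hexp.comp (u := fun x => -Real.log x) (by fun_prop)

/-- Two laws on the line coincide as soon as their distribution functions interlace. -/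
theorem measure_eq_of_Iic_interlace {μ ν : Measure ℝ} [IsProbabilityMeasure μ]
    [IsProbabilityMeasure ν] (h₁ : ∀ a b, a < b → μ (Set.Iic a) ≤ ν (Set.Iic b))
    (h₂ : ∀ a b, a < b → ν (Set.Iic a) ≤ μ (Set.Iic b)) : μ = ν := by
  have key : ∀ (μ ν : Measure ℝ) [IsProbabilityMeasure μ] [IsProbabilityMeasure ν],
      (∀ a b, a < b → μ (Set.Iic a) ≤ ν (Set.Iic b)) → ∀ a, cdf μ a ≤ cdf ν a := by
    intro μ ν _ _ h a
    have hcont : Tendsto (cdf ν) (𝓝[>] a) (𝓝 (cdf ν a)) :=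
      ((cdf ν).right_continuous a).mono_left (nhdsWithin_mono _ Set.Ioi_subset_Ici_self)
    refine ge_of_tendsto hcont ?_
    filter_upwards [self_mem_nhdsWithin] with b hb
    rw [cdf_eq_real, cdf_eq_real]
    exact ENNReal.toReal_mono (measure_ne_top _ _) (h a b hb)
  refine Measure.eq_of_cdf μ ν ?_
  ext a
  exact le_antisymm (key μ ν h₁ a) (key ν μ h₂ a)

/-! ### The stable subordinator and its inverse -/

theorem inverseProcess_le_of_lt {Ω : Type*} {L : ℝ≥0 → Ω → ℝ} {t u : ℝ≥0} {ω : Ω} (h : t < L u ω) :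
    inverseProcess L t ω ≤ u :=
  csInf_le (OrderBot.bddBelow _) h

theorem exists_lt_of_inverseProcess_lt {Ω : Type*} {L : ℝ≥0 → Ω → ℝ} {t v : ℝ≥0} {ω : Ω}
    (hex : ∃ u, (t : ℝ) < L u ω) (h : inverseProcess L t ω < v) : ∃ u < v, (t : ℝ) < L u ω := by
  obtain ⟨u, hu, huv⟩ := (csInf_lt_iff (OrderBot.bddBelow _) hex).1 h
  exact ⟨u, huv, hu⟩

section StableSubordinator

variable {Ω : Type*} [MeasurableSpace Ω] {P : Measure Ω} {α : ℝ} {L : ℝ≥0 → Ω → ℝ}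

theorem IsStableSubordinator.ae_nonneg (hL : IsStableSubordinator α L P) :
    ∀ᵐ ω ∂P, ∀ u, 0 ≤ L u ω := by
  filter_upwards [hL.monotone, hL.levy.zero] with ω hmono h0 u
  exact h0.symm.le.trans (hmono (zero_le (a := u)))

variable [IsProbabilityMeasure P]

/-- A stable subordinator is almost surely unbounded, by the Chernoff bound
`P(L(u) ≤ n) ≤ exp (n - u)`. Hence the infimum defining the inverse process is almost surely over
a nonempty set and does not take the default value `0`. -/
theorem IsStableSubordinator.ae_exists_lt (hL : IsStableSubordinator α L P) :
    ∀ᵐ ω ∂P, ∀ x : ℝ, ∃ u, x < L u ω := by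
  have hn : ∀ n : ℕ, ∀ᵐ ω ∂P, ∃ u, (n : ℝ) < L u ω := by
    intro n
    have hbound : ∀ k : ℕ, P.real {ω | ∀ u, L u ω ≤ n} ≤ Real.exp n * Real.exp (-(k : ℝ)) := by
      intro k
      have hint : Integrable (fun ω => Real.exp ((-1) * L k ω)) P := by
        have hm := hL.levy.measurable k
        refine Integrable.of_bound (by fun_prop) 1 ?_
        filter_upwards [hL.ae_nonneg] with ω hω
        rw [Real.norm_of_nonneg (Real.exp_pos _).le]
        exact Real.exp_le_one_iff.2 (by linarith [hω k])
      calc P.real {ω | ∀ u, L u ω ≤ n} ≤ P.real {ω | L k ω ≤ n} :=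
            measureReal_mono fun ω hω => hω k
        _ ≤ Real.exp (-(-1) * n) * mgf (L k) P (-1) :=
            measure_le_le_exp_mul_mgf _ (by norm_num) hint
        _ = Real.exp n * Real.exp (-(k : ℝ)) := by
            rw [mgf, hL.laplace k 1 zero_le_one]
            simp
    have hlim : Tendsto (fun k : ℕ => Real.exp n * Real.exp (-(k : ℝ))) atTop (𝓝 0) := by
      simpa using (Real.tendsto_exp_neg_atTop_nhds_zero.comp tendsto_natCast_atTop_atTop).const_mul
        (Real.exp n)
    have hzero : P.real {ω | ∀ u, L u ω ≤ n} = 0 :=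
      le_antisymm (ge_of_tendsto' hlim hbound) measureReal_nonneg
    rw [measureReal_eq_zero_iff] at hzero
    simpa [ae_iff] using hzero
  filter_upwards [ae_all_iff.2 hn] with ω hω x
  obtain ⟨n, hxn⟩ := exists_nat_gt x
  obtain ⟨u, hu⟩ := hω n
  exact ⟨u, hxn.trans hu⟩

/-- Self-similarity of the one-dimensional marginals of a stable subordinator, read off from the
Laplace transform. -/
theorem IsStableSubordinator.identDistrib_scale (hL : IsStableSubordinator α L P) (t u : ℝ≥0)
    (ht : 0 < t) :
    IdentDistrib (L u) (fun ω => t * L (u * t ^ (-α)) ω) P P := by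
  have hm := hL.levy.measurable
  refine identDistrib_of_laplace_eq (hm u).aemeasurable ((hm _).const_mul _).aemeasurable ?_ ?_ ?_
  · filter_upwards [hL.ae_nonneg] with ω hω using hω u
  · filter_upwards [hL.ae_nonneg] with ω hω using mul_nonneg t.2 (hω _)
  · intro n
    have h2 := hL.laplace (u * t ^ (-α)) (n * t) (by positivity)
    rw [hL.laplace u n (by positivity)]
    simp_rw [← mul_assoc, neg_mul]
    simp_rw [neg_mul] at h2
    rw [h2, Real.mul_rpow (by positivity) (by positivity)]
    have ht' : (0 : ℝ) < t := ht
    congr 2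
    push_cast
    rw [Real.rpow_neg ht'.le]
    field_simp

theorem IsStableSubordinator.aemeasurable_inverseProcess (hL : IsStableSubordinator α L P)
    (t : ℝ≥0) : AEMeasurable (inverseProcess L t) P := by
  have hnull : NullMeasurable (inverseProcess L t) P := by
    -- Almost surely `Y(t) < v` means that `L(q) > t` for some `q < v` in a countable dense set.
    obtain ⟨s, hs, hsd⟩ := TopologicalSpace.exists_countable_dense ℝ≥0
    refine fun A hA => measurable_of_Iio (δ := NullMeasurableSpace Ω P) (fun v => ?_) hA
    have hU : MeasurableSet (⋃ q ∈ s ∩ Set.Iio v, {ω | (t : ℝ) < L q ω}) :=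
      MeasurableSet.biUnion (hs.mono Set.inter_subset_left) fun q _ =>
        measurableSet_lt measurable_const (hL.levy.measurable q)
    refine hU.nullMeasurableSet.congr (eventuallyEq_set.2 ?_)
    filter_upwards [hL.monotone, hL.ae_exists_lt] with ω hmono hex
    simp only [Set.mem_iUnion]
    constructor
    · rintro ⟨q, ⟨-, hqv⟩, hq⟩
      exact (inverseProcess_le_of_lt hq).trans_lt hqv
    · intro h
      obtain ⟨u, huv, hu⟩ := exists_lt_of_inverseProcess_lt (hex t) h
      obtain ⟨q, hqs, huq, hqv⟩ := hsd.exists_between huv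
      exact ⟨q, ⟨hqs, hqv⟩, lt_of_lt_of_le hu (hmono huq.le)⟩
  exact hnull.aemeasurable

/-- Almost surely, the inverse of a stable subordinator is positive at positive levels, because
the paths of the subordinator are right-continuous and start at `0`. -/
theorem IsStableSubordinator.ae_inverseProcess_pos (hL : IsStableSubordinator α L P) {t : ℝ≥0}
    (ht : 0 < t) : ∀ᵐ ω ∂P, 0 < inverseProcess L t ω := by
  filter_upwards [hL.levy.zero, hL.levy.cadlag, hL.ae_exists_lt] with ω h0 hc hex
  have hcont : Tendsto (fun u => L u ω) (𝓝[≥] 0) (𝓝 (L 0 ω)) := (hc 0).1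
  rw [h0] at hcont
  have hev : ∀ᶠ u in 𝓝 (0 : ℝ≥0), L u ω < t := by
    simpa using hcont.eventually_lt_const (show (0 : ℝ) < t from ht)
  obtain ⟨δ, hδ, hlt⟩ := (NNReal.nhds_zero_basis.eventually_iff).1 hev
  refine lt_of_lt_of_le hδ (not_lt.1 fun hlt' => ?_)
  obtain ⟨u, hu, htu⟩ := exists_lt_of_inverseProcess_lt (hex t) hlt'
  exact lt_asymm htu (hlt hu)

theorem IsStableSubordinator.measure_inverseProcess_le (hL : IsStableSubordinator α L P)
    (t : ℝ≥0) {a b : ℝ≥0} (hab : a < b) :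
    P {ω | inverseProcess L t ω ≤ a} ≤ P {ω | (t : ℝ) < L b ω} := by
  refine measure_mono_ae ?_
  filter_upwards [hL.monotone, hL.ae_exists_lt] with ω hmono hex (hle : inverseProcess L t ω ≤ a)
  obtain ⟨u, hu, htu⟩ := exists_lt_of_inverseProcess_lt (hex t) (hle.trans_lt hab)
  exact lt_of_lt_of_le htu (hmono hu.le)

theorem IsStableSubordinator.measure_lt_eq (hL : IsStableSubordinator α L P) {t : ℝ≥0}
    (ht : 0 < t) (u : ℝ≥0) :
    P {ω | (t : ℝ) < L u ω} = P {ω | ((1 : ℝ≥0) : ℝ) < L (u * t ^ (-α)) ω} := by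
  have h := (hL.identDistrib_scale t u ht).measure_mem_eq (measurableSet_Ioi (a := (t : ℝ)))
  have ht' : (0 : ℝ) < t := ht
  have hset : {ω | ((1 : ℝ≥0) : ℝ) < L (u * t ^ (-α)) ω}
      = (fun ω => t * L (u * t ^ (-α)) ω) ⁻¹' Set.Ioi (t : ℝ) := by
    ext ω
    simp [ht']
  rw [hset]
  exact h

/-- The one-dimensional marginals of the inverse of an `α`-stable subordinator are self-similar
with index `α`. Both distribution functions are compared with
`b ↦ P(L(b) > t)`, which interlaces with them. -/
theorem IsStableSubordinator.identDistrib_inverseProcess (hL : IsStableSubordinator α L P)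
    {t : ℝ≥0} (ht : 0 < t) :
    IdentDistrib (inverseProcess L t) (fun ω => t ^ α * inverseProcess L 1 ω) P P := by
  have hY := hL.aemeasurable_inverseProcess
  have hpos : 0 < t ^ α := NNReal.rpow_pos ht
  have hscale : ∀ a x : ℝ≥0, t ^ α * x ≤ a ↔ x ≤ a * t ^ (-α) := by
    intro a x
    rw [NNReal.rpow_neg, ← div_eq_mul_inv, le_div_iff₀ hpos, mul_comm]
  have hlt : ∀ a b : ℝ≥0, a < b → a * t ^ (-α) < b * t ^ (-α) := fun a b hab =>
    mul_lt_mul_of_pos_right hab (NNReal.rpow_pos ht)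
  have h₁ : ∀ a b : ℝ≥0, a < b →
      P {ω | inverseProcess L t ω ≤ a} ≤ P {ω | t ^ α * inverseProcess L 1 ω ≤ b} := by
    intro a b hab
    refine (hL.measure_inverseProcess_le t hab).trans ?_
    rw [hL.measure_lt_eq ht]
    refine measure_mono fun ω hω => ?_
    exact (hscale _ _).2 (inverseProcess_le_of_lt hω)
  have h₂ : ∀ a b : ℝ≥0, a < b →
      P {ω | t ^ α * inverseProcess L 1 ω ≤ a} ≤ P {ω | inverseProcess L t ω ≤ b} := by
    intro a b hab
    simp_rw [hscale]
    refine (hL.measure_inverseProcess_le 1 (hlt a b hab)).trans ?_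
    rw [← hL.measure_lt_eq ht]
    exact measure_mono fun ω hω => inverseProcess_le_of_lt hω
  -- The interlacing passes to the real line: a negative bound is never met.
  have hreal : ∀ X Z : Ω → ℝ≥0, AEMeasurable X P → AEMeasurable Z P →
      (∀ a b : ℝ≥0, a < b → P {ω | X ω ≤ a} ≤ P {ω | Z ω ≤ b}) → ∀ a b : ℝ, a < b →
      P.map (fun ω => (X ω : ℝ)) (Set.Iic a) ≤ P.map (fun ω => (Z ω : ℝ)) (Set.Iic b) := by
    intro X Z hX hZ h a b hab
    rw [Measure.map_apply_of_aemeasurable (by fun_prop) measurableSet_Iic,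
      Measure.map_apply_of_aemeasurable (by fun_prop) measurableSet_Iic]
    rcases lt_or_ge a 0 with ha | ha
    · have hempty : (fun ω => (X ω : ℝ)) ⁻¹' Set.Iic a = ∅ := by
        ext ω
        simpa using ha.trans_le (X ω).2
      simp [hempty]
    · lift a to ℝ≥0 using ha
      lift b to ℝ≥0 using a.2.trans hab.le
      simpa [Set.preimage] using h a b (by exact_mod_cast hab)
  have hYt : AEMeasurable (inverseProcess L t) P := hY t
  have hY1 : AEMeasurable (fun ω => t ^ α * inverseProcess L 1 ω) P := (hY 1).const_mul _
  have hid : IdentDistrib (fun ω => (inverseProcess L t ω : ℝ))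
      (fun ω => ((t ^ α * inverseProcess L 1 ω : ℝ≥0) : ℝ)) P P := by
    have hYt' := hYt.coe_nnreal_real
    have hY1' := hY1.coe_nnreal_real
    have := Measure.isProbabilityMeasure_map hYt'
    have := Measure.isProbabilityMeasure_map hY1'
    exact ⟨hYt', hY1', measure_eq_of_Iic_interlace (hreal _ _ hYt hY1 h₁) (hreal _ _ hY1 hYt h₂)⟩
  simpa only [Function.comp_def, Real.toNNReal_coe] using hid.comp measurable_real_toNNReal

end StableSubordinator

/-! ### Sampling a right-continuous process at an independent random time -/

/-- The index `k` of the first grid point `k / (n + 1)` strictly above `x`. -/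
noncomputable def gridIndex (n : ℕ) (x : ℝ≥0) : ℕ := ⌊(n + 1) * x⌋₊ + 1

/-- The grid point `k / (n + 1)`. -/
noncomputable def gridPoint (n k : ℕ) : ℝ≥0 := k / (n + 1)

theorem measurable_gridIndex (n : ℕ) : Measurable (gridIndex n) := by
  unfold gridIndex
  exact (Nat.measurable_floor.comp (measurable_const.mul measurable_id)).add_const 1

theorem tendsto_gridPoint_gridIndex (x : ℝ≥0) :
    Tendsto (fun n => gridPoint n (gridIndex n x)) atTop (𝓝[≥] x) := by
  have hlow : ∀ n, x ≤ gridPoint n (gridIndex n x) := by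
    intro n
    have hn : (0 : ℝ≥0) < n + 1 := by positivity
    rw [gridPoint, gridIndex, le_div_iff₀ hn, mul_comm]
    push_cast
    exact (Nat.lt_floor_add_one _).le
  have hup : ∀ n, gridPoint n (gridIndex n x) ≤ x + 1 / ((n : ℝ≥0) + 1) := by
    intro n
    have hn : (0 : ℝ≥0) < n + 1 := by positivity
    rw [gridPoint, gridIndex, div_le_iff₀ hn, add_mul x, div_mul_cancel₀ _ hn.ne', mul_comm x]
    push_cast
    gcongr
    exact Nat.floor_le (zero_le)
  refine tendsto_nhdsWithin_iff.2 ⟨?_, Eventually.of_forall hlow⟩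
  refine tendsto_of_tendsto_of_tendsto_of_le_of_le tendsto_const_nhds ?_ hlow hup
  have h : Tendsto (fun n : ℕ => 1 / ((n : ℝ≥0) + 1)) atTop (𝓝 0) :=
    tendsto_one_div_add_atTop_nhds_zero_nat
  simpa using h.const_add x

section RandomTime

variable {Ω : Type*} [MeasurableSpace Ω] {P : Measure Ω} {M : ℝ≥0 → Ω → ℝ} {T : Ω → ℝ≥0}

theorem aemeasurable_comp_natIndex {X : ℕ → Ω → ℝ} (hX : ∀ k, Measurable (X k)) {K : Ω → ℕ}
    (hK : AEMeasurable K P) : AEMeasurable (fun ω => X (K ω) ω) P := by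
  have hF : Measurable fun p : ℕ × Ω => X p.1 p.2 := measurable_from_prod_countable_right hX
  exact hF.comp_aemeasurable (hK.prodMk aemeasurable_id)

theorem aemeasurable_comp_grid (hM : ∀ s, Measurable (M s)) (hT : AEMeasurable T P) (n : ℕ) :
    AEMeasurable (fun ω => M (gridPoint n (gridIndex n (T ω))) ω) P :=
  aemeasurable_comp_natIndex (fun k => hM (gridPoint n k))
    ((measurable_gridIndex n).comp_aemeasurable hT)

/-- A process with right-continuous paths, sampled at a random time, is a random variable. -/
theorem aemeasurable_comp_randomTime (hM : ∀ s, Measurable (M s))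
    (hrc : ∀ᵐ ω ∂P, ∀ s, ContinuousWithinAt (fun s => M s ω) (Set.Ici s) s)
    (hT : AEMeasurable T P) : AEMeasurable (fun ω => M (T ω) ω) P := by
  refine aemeasurable_of_tendsto_metrizable_ae atTop (aemeasurable_comp_grid hM hT) ?_
  filter_upwards [hrc] with ω hω
  exact (hω (T ω)).tendsto.comp (tendsto_gridPoint_gridIndex (T ω))

/-- Conditioning on an independent random time `T`: `𝔼[φ(M(T))] = 𝔼[G(T)]` with
`G(s) = 𝔼[φ(M(s))]`. For times in a grid this is Fubini's theorem for the joint law of the time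
and the countably many relevant values of `M`; right-continuity gives the general case. -/
theorem integral_comp_randomTime [IsProbabilityMeasure P] (hM : ∀ s, Measurable (M s))
    (hrc : ∀ᵐ ω ∂P, ∀ s, ContinuousWithinAt (fun s => M s ω) (Set.Ici s) s)
    (hT : AEMeasurable T P) (hind : IndepFun T (fun ω s => M s ω) P) {φ : ℝ → ℂ}
    (hφ : Continuous φ) {C : ℝ} (hC : ∀ x, ‖φ x‖ ≤ C) {G : ℝ≥0 → ℂ}
    (hG : ∀ s, ∫ ω, φ (M s ω) ∂P = G s) :
    ∫ ω, φ (M (T ω) ω) ∂P = ∫ ω, G (T ω) ∂P := by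
  have hGrc : ∀ s, ContinuousWithinAt G (Set.Ici s) s := by
    intro s
    obtain rfl : (fun s => ∫ ω, φ (M s ω) ∂P) = G := funext hG
    refine tendsto_integral_filter_of_dominated_convergence (μ := P) (fun _ => C)
      (Eventually.of_forall fun u => (hφ.measurable.comp (hM u)).aestronglyMeasurable)
      (Eventually.of_forall fun u => Eventually.of_forall fun ω => hC _)
      (integrable_const _) ?_
    filter_upwards [hrc] with ω hω
    exact (hφ.tendsto _).comp (hω s)
  have hGC : ∀ s, ‖G s‖ ≤ C := by
    intro s
    rw [← hG]
    simpa using norm_integral_le_of_norm_le_const (μ := P)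
      (Eventually.of_forall fun ω => hC (M s ω))
  have hgrid : ∀ n, ∫ ω, φ (M (gridPoint n (gridIndex n (T ω))) ω) ∂P
      = ∫ ω, G (gridPoint n (gridIndex n (T ω))) ∂P := by
    intro n
    have hK : AEMeasurable (fun ω => gridIndex n (T ω)) P :=
      (measurable_gridIndex n).comp_aemeasurable hT
    have hproc : Measurable fun ω (k : ℕ) => M (gridPoint n k) ω :=
      measurable_pi_lambda _ fun k => hM _
    have hind' : IndepFun (fun ω => gridIndex n (T ω)) (fun ω (k : ℕ) => M (gridPoint n k) ω) P :=
      hind.comp (ψ := fun (m : ℝ≥0 → ℝ) (k : ℕ) => m (gridPoint n k)) (measurable_gridIndex n)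
        (measurable_pi_lambda _ fun k => measurable_pi_apply _)
    have hF : Measurable fun p : ℕ × (ℕ → ℝ) => φ (p.2 p.1) :=
      measurable_from_prod_countable_right fun k => hφ.measurable.comp (measurable_pi_apply k)
    have := Measure.isProbabilityMeasure_map hK
    have := Measure.isProbabilityMeasure_map hproc.aemeasurable (μ := P)
    calc ∫ ω, φ (M (gridPoint n (gridIndex n (T ω))) ω) ∂P
        = ∫ p, φ (p.2 p.1) ∂(P.map fun ω => (gridIndex n (T ω),
            fun k : ℕ => M (gridPoint n k) ω)) :=
          (integral_map (hK.prodMk hproc.aemeasurable) hF.aestronglyMeasurable).symm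
      _ = ∫ k, ∫ m : ℕ → ℝ, φ (m k) ∂(P.map fun ω (k : ℕ) => M (gridPoint n k) ω)
            ∂(P.map fun ω => gridIndex n (T ω)) := by
          rw [hind'.map_prod_eq_prod_map_map hK hproc.aemeasurable, integral_prod]
          exact Integrable.of_bound hF.aestronglyMeasurable C (Eventually.of_forall fun p => hC _)
      _ = ∫ k, G (gridPoint n k) ∂(P.map fun ω => gridIndex n (T ω)) := by
          congr 1 with k
          have hφk : Measurable fun m : ℕ → ℝ => φ (m k) :=
            hφ.measurable.comp (measurable_pi_apply k)
          rw [integral_map hproc.aemeasurable hφk.aestronglyMeasurable, hG]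
      _ = ∫ ω, G (gridPoint n (gridIndex n (T ω))) ∂P :=
          integral_map hK (measurable_from_top.aestronglyMeasurable)
  have hleft : Tendsto (fun n => ∫ ω, φ (M (gridPoint n (gridIndex n (T ω))) ω) ∂P) atTop
      (𝓝 (∫ ω, φ (M (T ω) ω) ∂P)) := by
    refine tendsto_integral_of_dominated_convergence (fun _ => C)
      (fun n => (hφ.measurable.comp_aemeasurable
        (aemeasurable_comp_grid hM hT n)).aestronglyMeasurable)
      (integrable_const _) (fun n => Eventually.of_forall fun ω => hC _) ?_
    filter_upwards [hrc] with ω hω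
    exact (hφ.tendsto _).comp ((hω (T ω)).tendsto.comp (tendsto_gridPoint_gridIndex (T ω)))
  have hright : Tendsto (fun n => ∫ ω, G (gridPoint n (gridIndex n (T ω))) ∂P) atTop
      (𝓝 (∫ ω, G (T ω) ∂P)) := by
    refine tendsto_integral_of_dominated_convergence (fun _ => C) (fun n => ?_)
      (integrable_const _) (fun n => Eventually.of_forall fun ω => hGC _) ?_
    · exact ((measurable_from_top (f := fun k => G (gridPoint n k))).comp_aemeasurable
        ((measurable_gridIndex n).comp_aemeasurable hT)).aestronglyMeasurable
    · exact Eventually.of_forall fun ω =>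
        (hGrc (T ω)).tendsto.comp (tendsto_gridPoint_gridIndex (T ω))
  simp_rw [hgrid] at hleft
  exact tendsto_nhds_unique hleft hright

end RandomTime

/-! ### The cumulative rate function -/

section CumulativeRate

variable {rate : ℝ → ℝ}

theorem intervalIntegrable_rate (hint : LocallyIntegrableOn rate (Set.Ici 0) volume) (a b : ℝ≥0) :
    IntervalIntegrable rate volume a b := by
  have h : ∀ c : ℝ≥0, IntervalIntegrable rate volume 0 c := fun c => by
    refine (intervalIntegrable_iff_integrableOn_Icc_of_le c.2).2 ?_
    exact hint.integrableOn_compact_subset Set.Icc_subset_Ici_self isCompact_Icc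
  exact (h a).symm.trans (h b)

theorem continuous_cumulativeRate (hint : LocallyIntegrableOn rate (Set.Ici 0) volume) :
    Continuous fun s : ℝ≥0 => cumulativeRate rate s := by
  refine continuous_iff_continuousAt.2 fun s => ?_
  have hI : IntegrableOn rate (Set.uIcc 0 ((s : ℝ) + 1)) volume := by
    rw [Set.uIcc_of_le (by positivity)]
    exact hint.integrableOn_compact_subset Set.Icc_subset_Ici_self isCompact_Icc
  have hc := intervalIntegral.continuousOn_primitive_interval hI
  have hs : (s : ℝ) ∈ Set.uIcc 0 ((s : ℝ) + 1) := by
    rw [Set.uIcc_of_le (by positivity)]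
    exact ⟨s.2, by linarith⟩
  refine (hc s hs).tendsto.comp (tendsto_nhdsWithin_iff.2
    ⟨NNReal.continuous_coe.continuousAt, ?_⟩)
  filter_upwards [eventually_lt_nhds (show s < s + 1 from lt_add_one s)] with u hu
  rw [Set.uIcc_of_le (by positivity)]
  exact ⟨u.2, by exact_mod_cast hu.le⟩

theorem monotone_cumulativeRate (hpos : ∀ τ, 0 ≤ τ → 0 < rate τ)
    (hint : LocallyIntegrableOn rate (Set.Ici 0) volume) :
    Monotone fun s : ℝ≥0 => cumulativeRate rate s := by
  intro a b hab
  have hadd := intervalIntegral.integral_add_adjacent_intervals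
    (intervalIntegrable_rate hint 0 a) (intervalIntegrable_rate hint a b)
  have hnn : 0 ≤ ∫ τ in (a : ℝ)..b, rate τ :=
    intervalIntegral.integral_nonneg (by exact_mod_cast hab) fun τ hτ =>
      (hpos τ (a.2.trans hτ.1)).le
  simp only [NNReal.coe_zero] at hadd
  simp only [cumulativeRate]
  linarith

theorem cumulativeRate_nonneg (hpos : ∀ τ, 0 ≤ τ → 0 < rate τ) (s : ℝ≥0) :
    0 ≤ cumulativeRate rate s :=
  intervalIntegral.integral_nonneg s.2 fun τ hτ => (hpos τ hτ.1).le

end CumulativeRate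

/-! ### The non-homogeneous Poisson process -/

section NonhomogeneousPoisson

variable {Ω : Type*} [MeasurableSpace Ω] {P : Measure Ω} {N₁ : ℝ≥0 → Ω → ℕ} {rate : ℝ → ℝ}

theorem measurable_nonhomogeneousPoisson (hN₁ : IsStandardPoissonProcess N₁ P) (s : ℝ≥0) :
    Measurable fun ω => (nonhomogeneousPoisson N₁ rate s ω : ℝ) :=
  hN₁.levy.measurable _

/-- The time change by the continuous nondecreasing `Λ` preserves right-continuity. -/
theorem ae_rightContinuous_nonhomogeneousPoisson (hN₁ : IsStandardPoissonProcess N₁ P)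
    (hpos : ∀ τ, 0 ≤ τ → 0 < rate τ) (hint : LocallyIntegrableOn rate (Set.Ici 0) volume) :
    ∀ᵐ ω ∂P, ∀ s, ContinuousWithinAt
      (fun s => (nonhomogeneousPoisson N₁ rate s ω : ℝ)) (Set.Ici s) s := by
  filter_upwards [hN₁.levy.cadlag] with ω hω s
  have hcont : Continuous fun s : ℝ≥0 => (cumulativeRate rate s).toNNReal :=
    continuous_real_toNNReal.comp (continuous_cumulativeRate hint)
  exact (hω _).1.comp (f := fun s : ℝ≥0 => (cumulativeRate rate s).toNNReal)
    hcont.continuousWithinAt fun u hu =>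
      Real.toNNReal_mono (monotone_cumulativeRate hpos hint hu)

theorem integral_cexp_nonhomogeneousPoisson (hN₁ : IsStandardPoissonProcess N₁ P)
    (hpos : ∀ τ, 0 ≤ τ → 0 < rate τ) (s : ℝ≥0) (θ : ℝ) :
    ∫ ω, Complex.exp (θ * (nonhomogeneousPoisson N₁ rate s ω : ℝ) * Complex.I) ∂P =
      Complex.exp (cumulativeRate rate s * (Complex.exp (θ * Complex.I) - 1)) := by
  have hlaw := hN₁.law (cumulativeRate rate s).toNNReal
  have h := charFun_map_cast_poissonMeasure (cumulativeRate rate s).toNNReal θ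
  rw [charFun_apply_real, ← hlaw.map_eq, integral_map (by fun_prop) (by fun_prop),
    integral_map hlaw.aemeasurable (by fun_prop)] at h
  have hΛ : (((cumulativeRate rate s).toNNReal : ℝ) : ℂ) = cumulativeRate rate s := by
    rw [Real.coe_toNNReal _ (cumulativeRate_nonneg hpos s)]
  rw [← hΛ]
  exact h

end NonhomogeneousPoisson

/-! ### Convergence of the characteristic functions -/

theorem norm_cexp_mul_cexp_sub_one_le {x : ℝ} (hx : 0 ≤ x) (θ : ℝ) :
    ‖Complex.exp (x * (Complex.exp (θ * Complex.I) - 1))‖ ≤ 1 := by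
  rw [Complex.norm_exp, Real.exp_le_one_iff, Complex.re_ofReal_mul, Complex.sub_re,
    Complex.exp_ofReal_mul_I_re, Complex.one_re]
  exact mul_nonpos_of_nonneg_of_nonpos hx (by linarith [Real.cos_le_one θ])

/-- The characteristic function of a Poisson variable with parameter `x` scaled by `1 / c` is
asymptotically that of the constant `r` when `c → ∞` and `x / c → r`. -/
theorem tendsto_cexp_mul_cexp_sub_one {ι : Type*} {l : Filter ι} {x c : ι → ℝ} {r : ℝ}
    (hc : Tendsto c l atTop) (hx : Tendsto (fun i => x i / c i) l (𝓝 r)) (u : ℝ) :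
    Tendsto (fun i => Complex.exp (x i * (Complex.exp ((u / c i : ℝ) * Complex.I) - 1))) l
      (𝓝 (Complex.exp (u * r * Complex.I))) := by
  refine (Complex.continuous_exp.tendsto _).comp ?_
  have hderiv : HasDerivAt (fun h : ℝ => Complex.exp ((u * h : ℝ) * Complex.I))
      (u * Complex.I) 0 := by
    have h1 : HasDerivAt (fun h : ℝ => ((u * h : ℝ) : ℂ) * Complex.I) (u * Complex.I) 0 := by
      have := ((hasDerivAt_id (0 : ℝ)).const_mul u).ofReal_comp.mul_const Complex.I
      simpa using this
    simpa using h1.cexp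
  -- With `h = 1 / c`, the exponent is `(x / c)` times a difference quotient at `0`.
  -- With `h = 1 / c`, the exponent is `(x / c)` times a difference quotient at `0`.
  have hslope := hderiv.tendsto_slope_zero_right
  have hinv : Tendsto (fun i => (c i)⁻¹) l (𝓝[>] 0) := tendsto_inv_atTop_nhdsGT_zero.comp hc
  have hprod := (Complex.continuous_ofReal.tendsto r).comp hx |>.mul (hslope.comp hinv)
  have hlim : (r : ℂ) * (u * Complex.I) = u * r * Complex.I := by ring
  rw [hlim] at hprod
  refine hprod.congr' ?_
  filter_upwards [hc.eventually_gt_atTop 0] with i hi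
  have hi' : (c i : ℂ) ≠ 0 := by exact_mod_cast hi.ne'
  simp only [Function.comp_apply, inv_inv, zero_add, mul_zero, Complex.ofReal_zero, zero_mul,
    Complex.exp_zero, div_eq_mul_inv, Complex.real_smul, Complex.ofReal_mul, Complex.ofReal_inv]
  field_simp

theorem mainTheorem1 {Ω : Type*} [MeasurableSpace Ω] (P : Measure Ω) [IsProbabilityMeasure P]
    (α : ℝ) (hα₀ : 0 < α) (hα₁ : α < 1) (β : ℝ)
    (rate : ℝ → ℝ) (hrate_pos : ∀ τ, 0 ≤ τ → 0 < rate τ)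
    (hrate_int : LocallyIntegrableOn rate (Set.Ici 0) volume)
    (hrate_top : Tendsto (cumulativeRate rate) atTop atTop)
    (N₁ : ℝ≥0 → Ω → ℕ) (hN₁ : IsStandardPoissonProcess N₁ P)
    (L : ℝ≥0 → Ω → ℝ) (hL : IsStableSubordinator α L P)
    (hindep : IndepFun (fun ω t => inverseProcess L t ω)
      (fun ω t => nonhomogeneousPoisson N₁ rate t ω) P)
    (hreg : IsRegularlyVarying (cumulativeRate rate) β) :
    TendstoInDistribution
      (fun (t : ℝ≥0) ω =>
        (fractionalPoisson N₁ rate L t ω : ℝ) / cumulativeRate rate ((t : ℝ) ^ α))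
      atTop
      (fun ω => (inverseProcess L 1 ω : ℝ) ^ β)
      (fun _ => P) P := by
  have hY := hL.aemeasurable_inverseProcess
  have hM := measurable_nonhomogeneousPoisson (rate := rate) hN₁
  have hrc := ae_rightContinuous_nonhomogeneousPoisson hN₁ hrate_pos hrate_int
  have hind : ∀ t, IndepFun (inverseProcess L t)
      (fun ω s => (nonhomogeneousPoisson N₁ rate s ω : ℝ)) P := fun t =>
    hindep.comp (φ := fun y : ℝ≥0 → ℝ≥0 => y t) (ψ := fun (m : ℝ≥0 → ℕ) s => (m s : ℝ))
      (measurable_pi_apply t)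
      (measurable_pi_lambda _ fun s => measurable_from_top.comp (measurable_pi_apply s))
  have hX : ∀ t, AEMeasurable (fun ω =>
      (fractionalPoisson N₁ rate L t ω : ℝ) / cumulativeRate rate ((t : ℝ) ^ α)) P := fun t =>
    (aemeasurable_comp_randomTime hM hrc (hY t)).div_const _
  have hZ : AEMeasurable (fun ω => (inverseProcess L 1 ω : ℝ) ^ β) P :=
    (hY 1).coe_nnreal_real.pow_const β
  have htop : Tendsto (fun t : ℝ≥0 => (t : ℝ) ^ α) atTop atTop :=
    (tendsto_rpow_atTop hα₀).comp (NNReal.tendsto_coe_atTop.2 tendsto_id)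
  -- The characteristic function, with `Y(t)` replaced by its copy `t ^ α * Y(1)`.
  have hchar : ∀ t : ℝ≥0, 0 < t → ∀ u : ℝ,
      charFun (P.map fun ω =>
        (fractionalPoisson N₁ rate L t ω : ℝ) / cumulativeRate rate ((t : ℝ) ^ α)) u =
      ∫ ω, Complex.exp (cumulativeRate rate (inverseProcess L 1 ω * (t : ℝ) ^ α) *
        (Complex.exp ((u / cumulativeRate rate ((t : ℝ) ^ α) : ℝ) * Complex.I) - 1)) ∂P := by
    intro t ht u
    set c := cumulativeRate rate ((t : ℝ) ^ α)
    have hGm : Measurable fun s : ℝ≥0 => Complex.exp (cumulativeRate rate s *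
        (Complex.exp ((u / c : ℝ) * Complex.I) - 1)) := by
      have := (continuous_cumulativeRate hrate_int).measurable
      fun_prop
    rw [charFun_apply_real, integral_map (hX t) (by fun_prop)]
    calc ∫ ω, Complex.exp (u * ((fractionalPoisson N₁ rate L t ω : ℝ) / c : ℝ) * Complex.I) ∂P
        = ∫ ω, Complex.exp ((u / c : ℝ) * (fractionalPoisson N₁ rate L t ω : ℝ) * Complex.I)
            ∂P := by
          congr 1 with ω
          push_cast
          ring_nf
      _ = ∫ ω, Complex.exp (cumulativeRate rate (inverseProcess L t ω) *
            (Complex.exp ((u / c : ℝ) * Complex.I) - 1)) ∂P := by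
          refine integral_comp_randomTime (C := 1) (T := inverseProcess L t)
            (φ := fun x : ℝ => Complex.exp ((u / c : ℝ) * x * Complex.I))
            (G := fun s : ℝ≥0 => Complex.exp (cumulativeRate rate s *
              (Complex.exp ((u / c : ℝ) * Complex.I) - 1)))
            hM hrc (hY t) (hind t) (by fun_prop) (fun x => ?_)
            fun s => integral_cexp_nonhomogeneousPoisson hN₁ hrate_pos s _
          rw [← Complex.ofReal_mul, Complex.norm_exp_ofReal_mul_I]
      _ = ∫ ω, Complex.exp (cumulativeRate rate ((t ^ α * inverseProcess L 1 ω : ℝ≥0) : ℝ) *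
            (Complex.exp ((u / c : ℝ) * Complex.I) - 1)) ∂P :=
          ((hL.identDistrib_inverseProcess ht).comp hGm).integral_eq
      _ = _ := by
          congr 1 with ω
          rw [NNReal.coe_mul, NNReal.coe_rpow, mul_comm ((t : ℝ) ^ α)]
  have hlim : ∀ u : ℝ, Tendsto (fun t : ℝ≥0 => charFun (P.map fun ω =>
      (fractionalPoisson N₁ rate L t ω : ℝ) / cumulativeRate rate ((t : ℝ) ^ α)) u) atTop
      (𝓝 (charFun (P.map fun ω => (inverseProcess L 1 ω : ℝ) ^ β) u)) := by
    intro u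
    rw [charFun_apply_real, integral_map hZ (by fun_prop)]
    refine Tendsto.congr' ((eventually_gt_atTop 0).mono fun t ht => (hchar t ht u).symm) ?_
    refine tendsto_integral_filter_of_dominated_convergence (fun _ => 1)
      (Eventually.of_forall fun t => ?_)
      (Eventually.of_forall fun t => Eventually.of_forall fun ω => ?_) (integrable_const _) ?_
    · have h1 : AEMeasurable (fun ω => inverseProcess L 1 ω * t ^ α) P := (hY 1).mul_const _
      have h2 := (continuous_cumulativeRate hrate_int).measurable.comp_aemeasurable h1
      simp only [Function.comp_def, NNReal.coe_mul, NNReal.coe_rpow] at h2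
      exact AEMeasurable.aestronglyMeasurable (by fun_prop)
    · have := cumulativeRate_nonneg hrate_pos (inverseProcess L 1 ω * t ^ α)
      rw [NNReal.coe_mul, NNReal.coe_rpow] at this
      exact norm_cexp_mul_cexp_sub_one_le this _
    · filter_upwards [hL.ae_inverseProcess_pos one_pos] with ω hω
      exact tendsto_cexp_mul_cexp_sub_one (hrate_top.comp htop)
        ((hreg _ (by exact_mod_cast hω)).comp htop) u
  refine ⟨hX, hZ, tendsto_of_seq_tendsto fun t ht => ?_⟩
  exact ProbabilityMeasure.tendsto_iff_tendsto_charFun.2 fun u => (hlim u).comp ht
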